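/- Let $k \ge d$ be non-negative integers, let $\Sigma \in \mathbb{R}^{d\times d}$ be symmetric positive definite, and let $D$ be the Gaussian distribution $\mathcal{N}(0,\Sigma)$ on $\mathbb{R}^d$. Denote by $D^k$ the law of $k$ i.i.d. samples from $D$, and let $\mathrm{VS}_D^k$ be volume-rescaled sampling of size $k$ from $D$, i.e. the measure on $(\mathbb{R}^d)^k$ given for measurable $A$ by $$\mathrm{VS}_D^k(A)=\frac{\mathbb{E}_{(x_1,\dots,x_k)\sim D^k}\big[\mathbf 1_A(x_1,\dots,x_k)\,\det\big(\sum_{i=1}^k x_i x_i^\top\big)\big]}{d!\binom{k}{d}\det\big(\mathbb{E}_{x\sim D}[x x^\top]\big)}.$$ If $(\tilde x_1,\dots,\tilde x_k)$ has law $\mathrm{VS}_D^k$ and $\tilde X\in\mathbb{R}^{k\times d}$ is the random matrix with rows $\tilde x_1^\top,\dots,\tilde x_k^\top$, then $$\tilde X^\top \tilde X \sim W_d(k+2,\Sigma),$$ where the Wishart distribution $W_d(n,\Sigma)$ is the law of $Z^\top Z$ for a random matrix $Z\in\mathbb{R}^{n\times d}$ whose $n$ rows are i.i.d. from $\mathcal{N}(0,\Sigma)$.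 -/

import Mathlib

open MeasureTheory ProbabilityTheory
open scoped Nat

namespace VolumeSampling

/-- The entrywise (equivalently, Borel) σ-algebra on real matrices. -/
instance instMeasurableSpaceMatrix {m n : Type*} : MeasurableSpace (Matrix m n ℝ) :=
  inferInstanceAs (MeasurableSpace (m → n → ℝ))

/-- The matrix `X ∈ ℝ^{k × d}` whose (transposed) rows are the vectors `x 0, …, x (k - 1)`. -/
def rowMatrix {k d : ℕ} (x : Fin k → EuclideanSpace ℝ (Fin d)) : Matrix (Fin k) (Fin d) ℝ :=
  Matrix.of fun i j => x i j

/-- The second moment matrix `Σ_D = E[x xᵀ]` of a distribution `D` on `ℝ^d`. -/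
noncomputable def secondMoment {d : ℕ} (D : Measure (EuclideanSpace ℝ (Fin d))) :
    Matrix (Fin d) (Fin d) ℝ :=
  Matrix.of fun i j => ∫ x, x i * x j ∂D

/-- The rescaling factor `det (∑ i, x_i x_iᵀ)`, a non-negative number. -/
noncomputable def rescalingFactor {k d : ℕ} (x : Fin k → EuclideanSpace ℝ (Fin d)) : ℝ :=
  (∑ i, Matrix.vecMulVec (x i) (x i)).det

/-- Volume-rescaled sampling of size `k` from `D` (meant for `k ≥ d`, for `D` with finite second
moments and invertible `Σ_D`): the measure on `(ℝ^d)^k` given by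
`A ↦ E_{D^k}[1_A · det (∑ i, x_i x_iᵀ)] / (d! · (k choose d) · det Σ_D)`. -/
noncomputable def volumeSampling {d : ℕ} (k : ℕ) (D : Measure (EuclideanSpace ℝ (Fin d))) :
    Measure (Fin k → EuclideanSpace ℝ (Fin d)) :=
  (ENNReal.ofReal ((d ! : ℝ) * (k.choose d : ℝ) * (secondMoment D).det))⁻¹ •
    (Measure.pi fun _ : Fin k => D).withDensity fun x => ENNReal.ofReal (rescalingFactor x)

/-- The Wishart distribution `W_d(n, S)` with `n` degrees of freedom and scale matrix `S`: the law
of `Xᵀ X`, where the `n` rows of `X ∈ ℝ^{n × d}` are i.i.d. from `N(0, S)`. -/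
noncomputable def wishart {d : ℕ} (n : ℕ) (S : Matrix (Fin d) (Fin d) ℝ) :
    Measure (Matrix (Fin d) (Fin d) ℝ) :=
  (Measure.pi fun _ : Fin n => multivariateGaussian (0 : EuclideanSpace ℝ (Fin d)) S).map
    fun x => (rowMatrix x).transpose * rowMatrix x

end VolumeSampling

namespace VolumeSampling

/-! ### Complex-weighted moments of the standard Gaussian -/

/-! Both laws of the Gram matrix have the same characteristic function. A functional `L` acts on
symmetric matrices as `M ↦ tr (T M)` with `T` symmetric. Choosing `B` with `B Bᵀ = S` and `Bᵀ T B`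
diagonal (`exists_factor_apply_gram_eq`) and writing `x_i = B z_i` turns `exp (i L (Xᵀ X))` into a
product of phases `exp (i t_l z_il²)` in independent standard normals. With `φ_l = E exp (i t_l
z²)`, the Wishart side is `∏ φ_l ^ n` (`integral_cexp_gram`).

On the other side the weight is `det S * det (Zᵀ Z)`. In its Leibniz expansion odd moments vanish,
and each column `l` of a surviving term contributes one factor `E [z² exp (i t_l z²)] = φ_l ^ 3` in
place of `φ_l`: the two extra degrees of freedom. The signed count of surviving terms is the number
of injections `Fin d → Fin k`, which matches the normalisation
(`integrable_and_integral_det_mul_prod`). -/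

lemma integral_sq_mul_cexp_neg_mul_sq {b : ℂ} (hb : 0 < b.re) :
    Integrable (fun x : ℝ => (x : ℂ) ^ 2 * Complex.exp (-b * (x : ℂ) ^ 2)) ∧
      ∫ x : ℝ, (x : ℂ) ^ 2 * Complex.exp (-b * (x : ℂ) ^ 2) =
        (2 * b)⁻¹ * ∫ x : ℝ, Complex.exp (-b * (x : ℂ) ^ 2) := by
  have hb0 : b ≠ 0 := by rintro rfl; simp at hb
  have h0 := integrable_cexp_neg_mul_sq hb
  have h1 := integrable_mul_cexp_neg_mul_sq hb
  have h2 : Integrable (fun x : ℝ => (x : ℂ) ^ 2 * Complex.exp (-b * (x : ℂ) ^ 2)) := by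
    refine ((integrable_rpow_mul_exp_neg_mul_sq hb (s := 2) (by norm_num)).mono'
      (by fun_prop) (ae_of_all _ fun x => ?_))
    rw [norm_mul, norm_cexp_neg_mul_sq, norm_pow, Complex.norm_real, Real.norm_eq_abs, sq_abs,
      Real.rpow_two]
  refine ⟨h2, ?_⟩
  -- Integration by parts: the derivative of `x exp (-b x²)` has integral zero.
  have hd : ∀ x : ℝ, HasDerivAt (fun x : ℝ => (x : ℂ) * Complex.exp (-b * (x : ℂ) ^ 2))
      (Complex.exp (-b * (x : ℂ) ^ 2) -
        (2 * b) * ((x : ℂ) ^ 2 * Complex.exp (-b * (x : ℂ) ^ 2))) x := by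
    intro x
    have hx : HasDerivAt (fun z : ℂ => z * Complex.exp (-b * z ^ 2))
        (1 * Complex.exp (-b * (x : ℂ) ^ 2) + (x : ℂ) * (Complex.exp (-b * (x : ℂ) ^ 2) *
          (-b * (((2 : ℕ) : ℂ) * (x : ℂ) ^ (2 - 1) * 1)))) (x : ℂ) :=
      (hasDerivAt_id (x : ℂ)).mul (((hasDerivAt_id (x : ℂ)).pow 2).const_mul (-b)).cexp
    refine hx.comp_ofReal.congr_deriv ?_
    push_cast
    ring
  have h := integral_eq_zero_of_hasDerivAt_of_integrable hd (h0.sub (h2.const_mul _)) h1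
  rw [integral_sub h0 (h2.const_mul _), integral_const_mul, sub_eq_zero] at h
  rw [h, inv_mul_cancel_left₀ (mul_ne_zero two_ne_zero hb0)]

/-- The oscillating weight `x ↦ exp (i t x²)`. -/
noncomputable def quadraticPhase (t x : ℝ) : ℂ := Complex.exp (((t * x ^ 2 : ℝ) : ℂ) * Complex.I)

lemma continuous_quadraticPhase (t : ℝ) : Continuous (quadraticPhase t) := by
  unfold quadraticPhase
  fun_prop

lemma norm_quadraticPhase (t x : ℝ) : ‖quadraticPhase t x‖ = 1 :=
  Complex.norm_exp_ofReal_mul_I _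

lemma integrable_pow_mul_quadraticPhase (t : ℝ) (n : ℕ) :
    Integrable (fun x : ℝ => (x : ℂ) ^ n * quadraticPhase t x) (gaussianReal 0 1) := by
  have h : Integrable (fun x : ℝ => x ^ n) (gaussianReal 0 1) := by
    have := (memLp_id_gaussianReal (μ := 0) (v := 1) n).integrable_norm_pow'
    refine this.mono' (by fun_prop) (ae_of_all _ fun x => ?_)
    simp
  refine h.norm.mono' ?_ (ae_of_all _ fun x => ?_)
  · have := continuous_quadraticPhase t
    exact Continuous.aestronglyMeasurable (by fun_prop)
  · simp [norm_quadraticPhase]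

lemma integral_gaussianReal_mul_quadraticPhase (t : ℝ) (f : ℝ → ℂ) :
    ∫ x, f x * quadraticPhase t x ∂gaussianReal 0 1 =
      ((√(2 * Real.pi))⁻¹ : ℝ) *
        ∫ x : ℝ, f x * Complex.exp (-(1 / 2 - t * Complex.I) * (x : ℂ) ^ 2) := by
  rw [integral_gaussianReal_eq_integral_smul one_ne_zero, ← integral_const_mul]
  refine integral_congr_ae (ae_of_all _ fun x => ?_)
  simp only [gaussianPDFReal_def, quadraticPhase, Complex.real_smul, NNReal.coe_one, mul_one,
    sub_zero]
  have : Complex.exp (-(1 / 2 - t * Complex.I) * (x : ℂ) ^ 2) =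
      Complex.exp (((-x ^ 2 / 2 : ℝ) : ℂ)) * Complex.exp (((t * x ^ 2 : ℝ) : ℂ) * Complex.I) := by
    rw [← Complex.exp_add]
    congr 1
    push_cast
    ring
  rw [this, Complex.ofReal_mul, Complex.ofReal_exp]
  ring

lemma integral_id_mul_quadraticPhase (t : ℝ) :
    ∫ x : ℝ, (x : ℂ) * quadraticPhase t x ∂gaussianReal 0 1 = 0 := by
  rw [integral_gaussianReal_mul_quadraticPhase]
  have h := integral_neg_eq_self
    (fun x : ℝ => (x : ℂ) * Complex.exp (-(1 / 2 - t * Complex.I) * (x : ℂ) ^ 2)) volume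
  simp only [Complex.ofReal_neg, neg_sq, neg_mul, integral_neg] at h
  rw [mul_eq_zero]
  right
  rw [← self_eq_neg, eq_comm]
  simpa only [neg_mul] using h

/-- Only the square is needed, which avoids choosing a branch of the complex square root. -/
lemma integral_quadraticPhase_sq (t : ℝ) :
    (∫ x, quadraticPhase t x ∂gaussianReal 0 1) ^ 2 = (2 * (1 / 2 - t * Complex.I))⁻¹ := by
  have hb : 0 < (1 / 2 - t * Complex.I : ℂ).re := by simp
  have hb0 : (1 / 2 - t * Complex.I : ℂ) ≠ 0 := by
    intro h
    rw [h] at hb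
    simp at hb
  have h := integral_gaussianReal_mul_quadraticPhase t 1
  simp only [Pi.one_apply, one_mul] at h
  rw [h, integral_gaussian_complex hb, mul_pow, ← Complex.ofReal_pow, inv_pow,
    Real.sq_sqrt (by positivity), ← Complex.cpow_nat_mul]
  have : (Real.pi : ℂ) ≠ 0 := by exact_mod_cast Real.pi_ne_zero
  push_cast
  norm_num
  field_simp

lemma integral_sq_mul_quadraticPhase (t : ℝ) :
    ∫ x : ℝ, (x : ℂ) ^ 2 * quadraticPhase t x ∂gaussianReal 0 1 =
      (∫ x, quadraticPhase t x ∂gaussianReal 0 1) ^ 2 *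
        ∫ x, quadraticPhase t x ∂gaussianReal 0 1 := by
  have hb : 0 < (1 / 2 - t * Complex.I : ℂ).re := by simp
  have h := integral_gaussianReal_mul_quadraticPhase t 1
  simp only [Pi.one_apply, one_mul] at h
  rw [integral_quadraticPhase_sq, integral_gaussianReal_mul_quadraticPhase, h,
    (integral_sq_mul_cexp_neg_mul_sq hb).2]
  ring

/-! ### Determinants of Gram matrices of independent entries -/

/-- A collision of `f` produces two equal rows; without collisions the matrix is the identity. -/
lemma det_of_apply_eq_apply {d k : ℕ} (f : Fin d → Fin k) :
    (Matrix.of fun l m => if f l = f m then (1 : ℂ) else 0).det =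
      if Function.Injective f then 1 else 0 := by
  split_ifs with hf
  · rw [← Matrix.det_one (n := Fin d)]
    congr 1
    ext l m
    simp [Matrix.one_apply, hf.eq_iff]
  · rw [Function.not_injective_iff] at hf
    obtain ⟨a, b, hab, hne⟩ := hf
    exact Matrix.det_zero_of_row_eq hne (by ext m; simp [hab])

/-- Leibniz formula, with `f l` the row picked from the sum defining the `l`-th factor. Replacing
`σ` by its inverse makes column `l` occur exactly in rows `f (σ l)` and `f l`. -/
lemma det_transpose_mul_self_eq_sum {d k : ℕ} (w : Matrix (Fin k) (Fin d) ℂ) :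
    (w.transpose * w).det = ∑ σ : Equiv.Perm (Fin d), ∑ f : Fin d → Fin k,
      ((Equiv.Perm.sign σ : ℤ) : ℂ) * ∏ i, ∏ l,
        w i l ^ ((if f (σ l) = i then 1 else 0) + (if f l = i then 1 else 0)) := by
  rw [Matrix.det_apply', ← Equiv.sum_comp (Equiv.inv _)]
  refine Finset.sum_congr rfl fun σ _ => ?_
  simp only [Equiv.inv_apply, Equiv.Perm.sign_inv]
  rw [← Finset.mul_sum]
  congr 1
  simp only [Matrix.mul_apply, Matrix.transpose_apply, Finset.prod_univ_sum,
    Fintype.piFinset_univ]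
  refine Finset.sum_congr rfl fun f _ => ?_
  rw [Finset.prod_mul_distrib, ← Equiv.prod_comp σ fun l => w (f l) (σ⁻¹ l), Finset.prod_comm,
    ← Finset.prod_mul_distrib]
  refine Finset.prod_congr rfl fun l _ => ?_
  simp only [pow_add, Finset.prod_mul_distrib, pow_ite, pow_one, pow_zero]
  simp

lemma integrable_and_integral_det_mul_prod {d k : ℕ} {γ : Measure ℝ} [IsProbabilityMeasure γ]
    {g : Fin d → ℝ → ℂ} {c : Fin d → ℂ}
    (hint : ∀ l, ∀ n, Integrable (fun x : ℝ => (x : ℂ) ^ n * g l x) γ)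
    (h1 : ∀ l, ∫ x : ℝ, (x : ℂ) * g l x ∂γ = 0)
    (h2 : ∀ l, ∫ x : ℝ, (x : ℂ) ^ 2 * g l x ∂γ = c l * ∫ x, g l x ∂γ) :
    Integrable (fun z : Fin k → Fin d → ℝ =>
      (((Matrix.of z).transpose * Matrix.of z).det : ℂ) * ∏ i, ∏ l, g l (z i l))
      (Measure.pi fun _ => Measure.pi fun _ => γ) ∧
    ∫ z : Fin k → Fin d → ℝ,
      (((Matrix.of z).transpose * Matrix.of z).det : ℂ) * ∏ i, ∏ l, g l (z i l)
        ∂(Measure.pi fun _ => Measure.pi fun _ => γ) =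
      (k.descFactorial d : ℂ) * ∏ l, (c l * (∫ x, g l x ∂γ) ^ k) := by
  set e : Equiv.Perm (Fin d) → (Fin d → Fin k) → Fin k → Fin d → ℕ := fun σ f i l =>
    (if f (σ l) = i then 1 else 0) + (if f l = i then 1 else 0) with he
  have hexp : ∀ z : Fin k → Fin d → ℝ,
      (((Matrix.of z).transpose * Matrix.of z).det : ℂ) * ∏ i, ∏ l, g l (z i l) =
      ∑ σ : Equiv.Perm (Fin d), ∑ f : Fin d → Fin k, ((Equiv.Perm.sign σ : ℤ) : ℂ) *
        ∏ i, ∏ l, ((z i l : ℂ) ^ e σ f i l * g l (z i l)) := by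
    intro z
    have : (((Matrix.of z).transpose * Matrix.of z).det : ℂ) =
        (((Matrix.of z).map Complex.ofRealHom).transpose *
          (Matrix.of z).map Complex.ofRealHom).det := by
      rw [← Matrix.transpose_map, ← Matrix.map_mul]
      exact RingHom.map_det Complex.ofRealHom _
    rw [this, det_transpose_mul_self_eq_sum]
    simp only [Finset.sum_mul, mul_assoc, ← Finset.prod_mul_distrib, he]
    rfl
  have hterm : ∀ σ f, Integrable (fun z : Fin k → Fin d → ℝ =>
      ∏ i, ∏ l, ((z i l : ℂ) ^ e σ f i l * g l (z i l)))
      (Measure.pi fun _ => Measure.pi fun _ => γ) := fun σ f =>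
    Integrable.fintype_prod (f := fun i (y : Fin d → ℝ) =>
      ∏ l, ((y l : ℂ) ^ e σ f i l * g l (y l))) fun i =>
      Integrable.fintype_prod (f := fun l (x : ℝ) => (x : ℂ) ^ e σ f i l * g l x)
        fun l => hint l _
  have hval : ∀ σ f, ∫ z : Fin k → Fin d → ℝ, ∏ i, ∏ l, ((z i l : ℂ) ^ e σ f i l * g l (z i l))
      ∂(Measure.pi fun _ => Measure.pi fun _ => γ) =
      ∏ l, ((if f (σ l) = f l then 1 else 0) * (c l * (∫ x, g l x ∂γ) ^ k)) := by
    intro σ f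
    rw [integral_fintype_prod_eq_prod (f := fun i (y : Fin d → ℝ) =>
      ∏ l, ((y l : ℂ) ^ e σ f i l * g l (y l)))]
    simp_rw [fun i => integral_fintype_prod_eq_prod (μ := fun _ : Fin d => γ)
      (f := fun l (x : ℝ) => (x : ℂ) ^ e σ f i l * g l x)]
    rw [Finset.prod_comm]
    refine Finset.prod_congr rfl fun l _ => ?_
    split_ifs with h
    -- Column `l` has exponent 2 in row `f l` and 0 in the others.
    · have : ∀ i, ∫ x : ℝ, (x : ℂ) ^ e σ f i l * g l x ∂γ =
          (if f l = i then c l else 1) * ∫ x, g l x ∂γ := by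
        intro i
        by_cases hi : f l = i
        · simp [he, h, hi, h2]
        · simp [he, h, hi]
      simp only [this, Finset.prod_mul_distrib]
      simp
    · rw [zero_mul]
      -- Here row `f l` carries exponent 1, and the first moment vanishes.
      refine Finset.prod_eq_zero (Finset.mem_univ (f l)) ?_
      simp [he, h, h1]
  simp_rw [hexp]
  refine ⟨integrable_finsetSum _ fun σ _ => integrable_finsetSum _ fun f _ =>
    (hterm σ f).const_mul _, ?_⟩
  rw [integral_finsetSum _ fun σ _ => integrable_finsetSum _ fun f _ => (hterm σ f).const_mul _]
  simp_rw [fun σ => integral_finsetSum (μ := Measure.pi fun _ : Fin k => Measure.pi fun _ => γ)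
    Finset.univ fun f _ => (hterm σ f).const_mul ((Equiv.Perm.sign σ : ℤ) : ℂ),
    integral_const_mul, hval, Finset.prod_mul_distrib, ← mul_assoc]
  rw [Finset.sum_comm]
  simp_rw [← Finset.sum_mul]
  congr 2
  -- For fixed `f`, the signed sum is itself a Leibniz determinant.
  have : ∀ f : Fin d → Fin k, ∑ σ : Equiv.Perm (Fin d), ((Equiv.Perm.sign σ : ℤ) : ℂ) *
      ∏ l, (if f (σ l) = f l then (1 : ℂ) else 0) = if Function.Injective f then 1 else 0 := by
    intro f
    rw [← det_of_apply_eq_apply, Matrix.det_apply']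
    rfl
  simp_rw [this, Finset.sum_boole]
  rw [← Fintype.card_subtype, Fintype.card_congr (Equiv.subtypeInjectiveEquivEmbedding _ _),
    Fintype.card_embedding_eq, Fintype.card_fin, Fintype.card_fin]

/-! ### Gaussian vectors as linear images of independent standard Gaussians -/

/-- Any factor `B` is allowed, not just the symmetric square root; this freedom is what lets `B`
diagonalise a second form. -/
lemma multivariateGaussian_zero_eq_map_pi {d : ℕ} {S B : Matrix (Fin d) (Fin d) ℝ}
    (hB : B * B.transpose = S) :
    multivariateGaussian (0 : EuclideanSpace ℝ (Fin d)) S =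
      (Measure.pi fun _ : Fin d => gaussianReal 0 1).map fun z => WithLp.toLp 2 (B.mulVec z) := by
  have hS : S.PosSemidef := by
    rw [← hB, ← Matrix.conjTranspose_eq_transpose_of_trivial]
    exact Matrix.posSemidef_self_mul_conjTranspose B
  have hm : Measurable fun z : Fin d → ℝ => WithLp.toLp 2 (B.mulVec z) :=
    Continuous.measurable (by fun_prop)
  have := Measure.isProbabilityMeasure_map (μ := Measure.pi fun _ : Fin d => gaussianReal 0 1)
    hm.aemeasurable
  apply Measure.ext_of_charFun
  ext t
  rw [charFun_multivariateGaussian hS, charFun_apply,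
    integral_map hm.aemeasurable (Continuous.aestronglyMeasurable (by fun_prop))]
  have h := charFun_stdGaussian (WithLp.toLp 2 (B.transpose.mulVec t.ofLp))
  rw [← map_pi_eq_stdGaussian, charFun_apply, integral_map (by fun_prop)
    (Continuous.aestronglyMeasurable (by fun_prop))] at h
  convert h.symm using 1
  · congr 1
    rw [← Complex.ofReal_pow, EuclideanSpace.real_norm_sq_eq]
    simp only [inner_zero_right, ← hB, ← Matrix.mulVec_mulVec]
    have : ∑ i, (B.transpose.mulVec t.ofLp) i ^ 2 =
        t.ofLp ⬝ᵥ B.mulVec (B.transpose.mulVec t.ofLp) := by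
      rw [Matrix.dotProduct_mulVec, ← Matrix.mulVec_transpose]
      simp [dotProduct, sq]
    rw [← this]
    push_cast
    ring
  · refine integral_congr_ae (ae_of_all _ fun z => ?_)
    simp only [EuclideanSpace.inner_eq_star_dotProduct, star_trivial]
    rw [Matrix.dotProduct_mulVec, ← Matrix.mulVec_transpose]

lemma pi_multivariateGaussian_eq_map {d : ℕ} (k : ℕ) {S B : Matrix (Fin d) (Fin d) ℝ}
    (hB : B * B.transpose = S) :
    (Measure.pi fun _ : Fin k => multivariateGaussian (0 : EuclideanSpace ℝ (Fin d)) S) =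
      (Measure.pi fun _ : Fin k => Measure.pi fun _ : Fin d => gaussianReal 0 1).map
        fun z i => WithLp.toLp 2 (B.mulVec (z i)) := by
  have hm : Measurable fun z : Fin d → ℝ => WithLp.toLp 2 (B.mulVec z) :=
    Continuous.measurable (by fun_prop)
  have := Measure.isProbabilityMeasure_map (μ := Measure.pi fun _ : Fin d => gaussianReal 0 1)
    hm.aemeasurable
  rw [multivariateGaussian_zero_eq_map_pi hB]
  exact (Measure.pi_map_pi (fun _ => hm.aemeasurable)).symm

lemma secondMoment_multivariateGaussian {d : ℕ} {S : Matrix (Fin d) (Fin d) ℝ}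
    (hS : S.PosSemidef) :
    secondMoment (multivariateGaussian (0 : EuclideanSpace ℝ (Fin d)) S) = S := by
  ext i j
  have h0 : ∀ i, ∫ x, x i ∂multivariateGaussian (0 : EuclideanSpace ℝ (Fin d)) S = 0 := by
    intro i
    have := ContinuousLinearMap.integral_comp_id_comm
      (IsGaussian.integrable_id (μ := multivariateGaussian (0 : EuclideanSpace ℝ (Fin d)) S))
      (EuclideanSpace.proj i : EuclideanSpace ℝ (Fin d) →L[ℝ] ℝ)
    simpa using this
  rw [← covariance_eval_multivariateGaussian (μ := 0) hS i j]
  simp [secondMoment, covariance, h0]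

/-- Take `B = R U` with `R Rᵀ = S` and `U` orthogonal diagonalising `Rᵀ T R`; `U` cancels in `B Bᵀ`.
-/
lemma exists_mul_transpose_eq_and_diagonal {d : ℕ} {S T : Matrix (Fin d) (Fin d) ℝ}
    (hS : S.PosSemidef) (hT : T.transpose = T) :
    ∃ (B : Matrix (Fin d) (Fin d) ℝ) (t : Fin d → ℝ),
      B * B.transpose = S ∧ B.transpose * T * B = Matrix.diagonal t := by
  obtain ⟨R, hR⟩ : ∃ R : Matrix (Fin d) (Fin d) ℝ, R * R.transpose = S := by
    open scoped MatrixOrder in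
    obtain ⟨C, hC⟩ := CStarAlgebra.nonneg_iff_eq_star_mul_self.mp hS.nonneg
    refine ⟨C.transpose, ?_⟩
    rw [hC, Matrix.transpose_transpose, Matrix.star_eq_conjTranspose,
      Matrix.conjTranspose_eq_transpose_of_trivial]
  have hH : (R.transpose * T * R).IsHermitian := by
    rw [Matrix.IsHermitian, Matrix.conjTranspose_eq_transpose_of_trivial]
    simp [Matrix.transpose_mul, hT, Matrix.mul_assoc]
  set U : Matrix (Fin d) (Fin d) ℝ := (hH.eigenvectorUnitary).1 with hU
  have hstar : star U = U.transpose := by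
    rw [Matrix.star_eq_conjTranspose, Matrix.conjTranspose_eq_transpose_of_trivial]
  have hUU : U * U.transpose = 1 := by
    rw [← hstar]
    exact Unitary.coe_mul_star_self _
  have hU'U : U.transpose * U = 1 := by
    rw [← hstar]
    exact Unitary.coe_star_mul_self _
  refine ⟨R * U, hH.eigenvalues, ?_, ?_⟩
  · rw [Matrix.transpose_mul, Matrix.mul_assoc, ← Matrix.mul_assoc U, hUU, Matrix.one_mul, hR]
  · have h := hH.spectral_theorem
    rw [Unitary.conjStarAlgAut_apply, ← hU, hstar] at h
    change _ = U * Matrix.diagonal hH.eigenvalues * U.transpose at h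
    generalize hH.eigenvalues = e at h ⊢
    calc (R * U).transpose * T * (R * U) = U.transpose * (R.transpose * T * R) * U := by
          simp only [Matrix.transpose_mul, Matrix.mul_assoc]
      _ = (U.transpose * U) * Matrix.diagonal e * (U.transpose * U) := by
          rw [h]
          simp only [Matrix.mul_assoc]
      _ = _ := by rw [hU'U, Matrix.one_mul, Matrix.mul_one]

/-! ### Gram matrices -/

/-- The Gram matrix `Xᵀ X`, as an element of the normed space `ℝ^{d × d}`. -/
def gram {k d : ℕ} (x : Fin k → EuclideanSpace ℝ (Fin d)) : Fin d → Fin d → ℝ :=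
  (rowMatrix x).transpose * rowMatrix x

lemma gram_apply {k d : ℕ} (x : Fin k → EuclideanSpace ℝ (Fin d)) (a b : Fin d) :
    gram x a b = ∑ i, x i a * x i b := by
  simp [gram, rowMatrix, Matrix.mul_apply]

lemma continuous_gram {k d : ℕ} :
    Continuous (gram : (Fin k → EuclideanSpace ℝ (Fin d)) → Fin d → Fin d → ℝ) := by
  refine continuous_pi fun a => continuous_pi fun b => ?_
  simp only [gram_apply]
  fun_prop

lemma rescalingFactor_eq_det_gram {k d : ℕ} (x : Fin k → EuclideanSpace ℝ (Fin d)) :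
    rescalingFactor x = (Matrix.of (gram x)).det := by
  unfold rescalingFactor
  congr 1
  ext a b
  simp [gram_apply, Matrix.sum_apply, Matrix.vecMulVec_apply]

lemma rescalingFactor_nonneg {k d : ℕ} (x : Fin k → EuclideanSpace ℝ (Fin d)) :
    0 ≤ rescalingFactor x := by
  rw [rescalingFactor_eq_det_gram]
  have := Matrix.posSemidef_conjTranspose_mul_self (rowMatrix x)
  rw [Matrix.conjTranspose_eq_transpose_of_trivial] at this
  exact this.det_nonneg

lemma continuous_rescalingFactor {k d : ℕ} :
    Continuous (rescalingFactor : (Fin k → EuclideanSpace ℝ (Fin d)) → ℝ) := by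
  simp only [funext rescalingFactor_eq_det_gram]
  exact Continuous.matrix_det continuous_gram

lemma gram_mulVec {k d : ℕ} (B : Matrix (Fin d) (Fin d) ℝ) (z : Fin k → Fin d → ℝ) :
    gram (fun i => WithLp.toLp 2 (B.mulVec (z i))) =
      (B * ((Matrix.of z).transpose * Matrix.of z) * B.transpose :
        Matrix (Fin d) (Fin d) ℝ) := by
  have : rowMatrix (fun i => WithLp.toLp 2 (B.mulVec (z i))) = Matrix.of z * B.transpose := by
    ext i j
    simp [rowMatrix, Matrix.mul_apply, Matrix.mulVec, dotProduct, mul_comm]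
  rw [gram, this, Matrix.transpose_mul, Matrix.transpose_transpose]
  simp only [Matrix.mul_assoc]
  rfl

/-- The matrix representing `L` can be symmetrised, since its antisymmetric part pairs to zero with
symmetric matrices. -/
lemma exists_symmetric_apply_gram_eq_trace {d : ℕ} (L : (Fin d → Fin d → ℝ) →L[ℝ] ℝ) :
    ∃ T : Matrix (Fin d) (Fin d) ℝ, T.transpose = T ∧
      ∀ M : Matrix (Fin d) (Fin d) ℝ, M.transpose = M → L M = (T * M).trace := by
  set V : Matrix (Fin d) (Fin d) ℝ := Matrix.of fun a b => L (Pi.single b (Pi.single a 1)) with hV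
  have hL : ∀ M : Matrix (Fin d) (Fin d) ℝ, L M = (V * M).trace := by
    intro M
    have hM : (M : Fin d → Fin d → ℝ) = ∑ b, ∑ a, M b a • Pi.single b (Pi.single a (1 : ℝ)) := by
      ext b a
      simp [Finset.sum_apply, Pi.single_apply, ite_apply]
    conv_lhs => rw [hM]
    simp only [map_sum, map_smul, Matrix.trace, Matrix.diag, Matrix.mul_apply]
    rw [Finset.sum_comm]
    simp [hV, mul_comm]
  refine ⟨(1 / 2 : ℝ) • (V + V.transpose), ?_, fun M hM => ?_⟩
  · rw [Matrix.transpose_smul, Matrix.transpose_add, Matrix.transpose_transpose, add_comm]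
  · have : (V.transpose * M).trace = (V * M).trace := by
      rw [← Matrix.trace_transpose, Matrix.transpose_mul, Matrix.transpose_transpose, hM,
        Matrix.trace_mul_comm]
    rw [hL, Matrix.smul_mul, Matrix.add_mul, Matrix.trace_smul, Matrix.trace_add, this]
    simp only [smul_eq_mul]
    ring

/-- In suitable coordinates, a linear functional of the Gram matrix is a diagonal quadratic form. -/
lemma exists_factor_apply_gram_eq {d : ℕ} {S : Matrix (Fin d) (Fin d) ℝ} (hS : S.PosSemidef)
    (L : (Fin d → Fin d → ℝ) →L[ℝ] ℝ) :
    ∃ (B : Matrix (Fin d) (Fin d) ℝ) (t : Fin d → ℝ), B * B.transpose = S ∧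
      ∀ (k : ℕ) (z : Fin k → Fin d → ℝ),
        L (gram fun i => WithLp.toLp 2 (B.mulVec (z i))) = ∑ i, ∑ l, t l * z i l ^ 2 := by
  obtain ⟨T, hT, hLT⟩ := exists_symmetric_apply_gram_eq_trace L
  obtain ⟨B, t, hB, ht⟩ := exists_mul_transpose_eq_and_diagonal hS hT
  refine ⟨B, t, hB, fun k z => ?_⟩
  rw [gram_mulVec, hLT _ (by simp [Matrix.transpose_mul, Matrix.mul_assoc])]
  have : (T * (B * ((Matrix.of z).transpose * Matrix.of z) * B.transpose)).trace =
      (B.transpose * T * B * ((Matrix.of z).transpose * Matrix.of z)).trace := by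
    rw [← Matrix.mul_assoc, Matrix.trace_mul_comm]
    simp only [Matrix.mul_assoc]
  rw [this, ht, Finset.sum_comm]
  simp [Matrix.trace, Matrix.mul_apply, Matrix.diagonal_apply, Finset.mul_sum, sq]

lemma cexp_apply_gram_eq_prod {d k : ℕ} {L : (Fin d → Fin d → ℝ) →L[ℝ] ℝ}
    {x : Fin k → EuclideanSpace ℝ (Fin d)} {t : Fin d → ℝ} {z : Fin k → Fin d → ℝ}
    (h : L (gram x) = ∑ i, ∑ l, t l * z i l ^ 2) :
    Complex.exp (L (gram x) * Complex.I) = ∏ i, ∏ l, quadraticPhase (t l) (z i l) := by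
  simp only [h, quadraticPhase, ← Complex.exp_sum, ← Finset.sum_mul]
  push_cast
  rfl

/-! ### Characteristic functions of the laws of the Gram matrices -/

lemma integral_cexp_gram {d : ℕ} (n : ℕ) {S B : Matrix (Fin d) (Fin d) ℝ}
    (hB : B * B.transpose = S) {L : (Fin d → Fin d → ℝ) →L[ℝ] ℝ} {t : Fin d → ℝ}
    (hL : ∀ (k : ℕ) (z : Fin k → Fin d → ℝ),
      L (gram fun i => WithLp.toLp 2 (B.mulVec (z i))) = ∑ i, ∑ l, t l * z i l ^ 2) :
    ∫ x : Fin n → EuclideanSpace ℝ (Fin d), Complex.exp (L (gram x) * Complex.I)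
      ∂(Measure.pi fun _ => multivariateGaussian 0 S) =
      ∏ l, (∫ x, quadraticPhase (t l) x ∂gaussianReal 0 1) ^ n := by
  have hc := continuous_gram (k := n) (d := d)
  rw [pi_multivariateGaussian_eq_map n hB, integral_map (Measurable.aemeasurable
    (Continuous.measurable (by fun_prop))) (Continuous.aestronglyMeasurable (by fun_prop))]
  have hcexp : ∀ z : Fin n → Fin d → ℝ,
      Complex.exp (L (gram fun i => WithLp.toLp 2 (B.mulVec (z i))) * Complex.I) =
        ∏ i, ∏ l, quadraticPhase (t l) (z i l) := fun z => cexp_apply_gram_eq_prod (hL n z)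
  rw [integral_congr_ae (ae_of_all _ hcexp), integral_fintype_prod_eq_prod
    (f := fun (_ : Fin n) (y : Fin d → ℝ) => ∏ l, quadraticPhase (t l) (y l))]
  simp_rw [integral_fintype_prod_eq_prod (μ := fun _ : Fin d => gaussianReal 0 1)
    (f := fun l (x : ℝ) => quadraticPhase (t l) x)]
  simp [Finset.prod_pow]

lemma rescalingFactor_mulVec {d k : ℕ} {S B : Matrix (Fin d) (Fin d) ℝ}
    (hB : B * B.transpose = S) (z : Fin k → Fin d → ℝ) :
    rescalingFactor (fun i => WithLp.toLp 2 (B.mulVec (z i))) =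
      S.det * ((Matrix.of z).transpose * Matrix.of z).det := by
  rw [rescalingFactor_eq_det_gram, gram_mulVec, ← hB]
  change Matrix.det (B * _ * _) = _
  simp only [Matrix.det_mul]
  ring

lemma integrable_and_integral_rescalingFactor_mul_cexp_gram {d : ℕ} (k : ℕ)
    {S B : Matrix (Fin d) (Fin d) ℝ} (hB : B * B.transpose = S)
    {L : (Fin d → Fin d → ℝ) →L[ℝ] ℝ} {t : Fin d → ℝ}
    (hL : ∀ (k : ℕ) (z : Fin k → Fin d → ℝ),
      L (gram fun i => WithLp.toLp 2 (B.mulVec (z i))) = ∑ i, ∑ l, t l * z i l ^ 2) :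
    Integrable (fun x : Fin k → EuclideanSpace ℝ (Fin d) =>
      (rescalingFactor x : ℂ) * Complex.exp (L (gram x) * Complex.I))
      (Measure.pi fun _ => multivariateGaussian 0 S) ∧
    ∫ x : Fin k → EuclideanSpace ℝ (Fin d),
      (rescalingFactor x : ℂ) * Complex.exp (L (gram x) * Complex.I)
      ∂(Measure.pi fun _ => multivariateGaussian 0 S) =
      (S.det * k.descFactorial d : ℂ) *
        ∏ l, (∫ x, quadraticPhase (t l) x ∂gaussianReal 0 1) ^ (k + 2) := by
  have hc := continuous_gram (k := k) (d := d)
  have hr := continuous_rescalingFactor (k := k) (d := d)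
  have hm : AEMeasurable (fun (z : Fin k → Fin d → ℝ) i => WithLp.toLp 2 (B.mulVec (z i)))
      (Measure.pi fun _ : Fin k => Measure.pi fun _ : Fin d => gaussianReal 0 1) :=
    Measurable.aemeasurable (Continuous.measurable (by fun_prop))
  obtain ⟨hi, hv⟩ := integrable_and_integral_det_mul_prod (k := k) (γ := gaussianReal 0 1)
    (g := fun l => quadraticPhase (t l))
    (c := fun l => (∫ x, quadraticPhase (t l) x ∂gaussianReal 0 1) ^ 2)
    (fun l => integrable_pow_mul_quadraticPhase (t l))
    (fun l => integral_id_mul_quadraticPhase (t l))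
    (fun l => integral_sq_mul_quadraticPhase (t l))
  have hcomp : ∀ z : Fin k → Fin d → ℝ,
      (rescalingFactor (fun i => WithLp.toLp 2 (B.mulVec (z i))) : ℂ) *
        Complex.exp (L (gram fun i => WithLp.toLp 2 (B.mulVec (z i))) * Complex.I) =
      (S.det : ℂ) * ((((Matrix.of z).transpose * Matrix.of z).det : ℂ) *
        ∏ i, ∏ l, quadraticPhase (t l) (z i l)) := by
    intro z
    rw [cexp_apply_gram_eq_prod (hL k z), rescalingFactor_mulVec hB]
    push_cast
    ring
  rw [pi_multivariateGaussian_eq_map k hB]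
  constructor
  · rw [integrable_map_measure (Continuous.aestronglyMeasurable (by fun_prop)) hm]
    exact (hi.const_mul (S.det : ℂ)).congr (ae_of_all _ fun z => (hcomp z).symm)
  · rw [integral_map hm (Continuous.aestronglyMeasurable (by fun_prop))]
    simp only [hcomp]
    rw [integral_const_mul, hv, mul_assoc]
    simp only [← pow_add, add_comm]

lemma integrable_rescalingFactor {d : ℕ} (k : ℕ) {S : Matrix (Fin d) (Fin d) ℝ}
    (hS : S.PosSemidef) :
    Integrable (rescalingFactor : (Fin k → EuclideanSpace ℝ (Fin d)) → ℝ)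
      (Measure.pi fun _ => multivariateGaussian 0 S) := by
  -- With `L = 0` the exponential is identically 1.
  obtain ⟨B, t, hB, hL⟩ := exists_factor_apply_gram_eq hS 0
  simpa using (integrable_and_integral_rescalingFactor_mul_cexp_gram k hB hL).1.re

lemma volumeSampling_const_pos {d k : ℕ} (hdk : d ≤ k) {S : Matrix (Fin d) (Fin d) ℝ}
    (hS : S.PosDef) : 0 < (d ! : ℝ) * (k.choose d : ℝ) * S.det := by
  have := hS.det_pos
  have := Nat.choose_pos hdk
  have := d.factorial_pos
  positivity

/-- Finiteness suffices for characteristic functions to determine the measure; total mass one need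
not be shown separately. -/
lemma isFiniteMeasure_volumeSampling {d k : ℕ} (hdk : d ≤ k) {S : Matrix (Fin d) (Fin d) ℝ}
    (hS : S.PosDef) : IsFiniteMeasure (volumeSampling k (multivariateGaussian 0 S)) := by
  have := isFiniteMeasure_withDensity_ofReal (integrable_rescalingFactor k hS.posSemidef).2
  refine Measure.smul_finite _ ?_
  rw [secondMoment_multivariateGaussian hS.posSemidef]
  simpa using volumeSampling_const_pos hdk hS

/-- The Gram matrix of a volume-rescaled Gaussian sample of size `k` is Wishart with `k + 2`
degrees of freedom. -/
lemma map_gram_volumeSampling {d k : ℕ} (hdk : d ≤ k) {S : Matrix (Fin d) (Fin d) ℝ}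
    (hS : S.PosDef) :
    (volumeSampling k (multivariateGaussian 0 S)).map gram =
      (Measure.pi fun _ : Fin (k + 2) => multivariateGaussian 0 S).map gram := by
  have := isFiniteMeasure_volumeSampling hdk hS
  have hpos := volumeSampling_const_pos hdk hS
  have hc := continuous_gram (k := k) (d := d)
  have hc2 := continuous_gram (k := k + 2) (d := d)
  have hr := continuous_rescalingFactor (k := k) (d := d)
  apply Measure.ext_of_charFunDual
  ext L
  -- The same `B` and `t` serve the sample sizes `k` and `k + 2`.
  obtain ⟨B, t, hB, hL⟩ := exists_factor_apply_gram_eq hS.posSemidef L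
  rw [charFunDual_apply, charFunDual_apply,
    integral_map hc.measurable.aemeasurable (Continuous.aestronglyMeasurable (by fun_prop)),
    integral_map hc2.measurable.aemeasurable (Continuous.aestronglyMeasurable (by fun_prop)),
    integral_cexp_gram _ hB hL, volumeSampling, integral_smul_measure,
    integral_withDensity_eq_integral_toReal_smul (by fun_prop) (by simp),
    secondMoment_multivariateGaussian hS.posSemidef]
  simp only [ENNReal.toReal_ofReal (rescalingFactor_nonneg _), Complex.real_smul]
  rw [(integrable_and_integral_rescalingFactor_mul_cexp_gram k hB hL).2, ENNReal.toReal_inv,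
    ENNReal.toReal_ofReal hpos.le, Nat.descFactorial_eq_factorial_mul_choose, ← mul_assoc]
  -- The products of `φ_l ^ (k + 2)` agree; what remains is that the constant in front is 1.
  refine mul_left_eq_self₀.2 (Or.inl ?_)
  have h := congrArg (fun r : ℝ => (r : ℂ)) (inv_mul_cancel₀ hpos.ne')
  rw [← Complex.ofReal_one, ← h]
  push_cast
  ring

end VolumeSampling

theorem theorem5 (d k : ℕ) (hdk : d ≤ k)
    (S : Matrix (Fin d) (Fin d) ℝ) (hS : S.PosDef)
    (D : Measure (EuclideanSpace ℝ (Fin d)))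
    (hD : D = multivariateGaussian (0 : EuclideanSpace ℝ (Fin d)) S)
    {Ω : Type*} [MeasurableSpace Ω] (P : Measure Ω)
    (x : Ω → Fin k → EuclideanSpace ℝ (Fin d))
    (hx : HasLaw x (VolumeSampling.volumeSampling k D) P) :
    HasLaw (fun ω => (VolumeSampling.rowMatrix (x ω)).transpose * VolumeSampling.rowMatrix (x ω))
      (VolumeSampling.wishart (k + 2) S) P := by
  subst hD
  have h : HasLaw VolumeSampling.gram (VolumeSampling.wishart (k + 2) S)
      (VolumeSampling.volumeSampling k (multivariateGaussian 0 S)) :=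
    ⟨VolumeSampling.continuous_gram.measurable.aemeasurable,
      VolumeSampling.map_gram_volumeSampling hdk hS⟩
  exact h.fun_comp hx
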